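/- Give every ordinal the order topology, and let every set of ordinals carry the subspace topology. For ordinals $\beta,\alpha$ and a positive integer $k$, write $\beta\to_{cl}(\alpha,k)^2$ (respectively $\beta\to_{top}(\alpha,k)^2$) if for every coloring $c:[\beta]^2\to\{\text{red},\text{blue}\}$ of the two-element subsets of $\beta$ there is a set $X\subseteq\beta$ such that either all pairs from $X$ are red and $X$ is order-homeomorphic (respectively homeomorphic) to $\alpha$, or all pairs from $X$ are blue and $X$ has exactly $k$ elements. Here $X$ is \emph{order-homeomorphic} to $\alpha$ if some bijection $X\to\alpha$ is both an order-isomorphism and a homeomorphism; such an $X$ is also called a closed copy of $\alpha$. Let $R^{cl}(\alpha,k)$ and $R^{top}(\alpha,k)$ denote the least ordinal $\beta$ with $\beta\to_{cl}(\alpha,k)^2$ and $\beta\to_{top}(\alpha,k)^2$, respectively, when one exists. Theorem. Let $k$ be a positive integer. Then: (1) $\omega^\omega\to_{cl}(\omega^2,k)^2$. (2) $R^{top}(\omega^2,k)$ and $R^{cl}(\omega^2,k)$ exist, and $R^{top}(\omega^2,k)=R^{cl}(\omega^2,k)\leq\omega^\omega$. (3) For every coloring $c:[\omega^\omega]^2\to\{\text{red},\text{blue}\}$,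 there is a set of $k$ points of $\omega^\omega$ all of whose pairs are blue, or a closed copy in $\omega^\omega$ of some ordinal larger than $\omega^2$ all of whose pairs are red, or a closed copy of $\omega^2$ that is cofinal in $\omega^\omega$ and all of whose pairs are red. -/

import Mathlib

/-!
Ordinals carry Mathlib's order topology, and an ordinal `β` is identified with the space
`Set.Iio β` of its predecessors. `[β]^n` is `Set.powersetCard (Set.Iio β) n`.
-/

universe u v

namespace OrdinalRamsey

/-- `X ⊆ β` is `i`-homogeneous for the coloring `c` of `[β]^n`: `[X]^n ⊆ c⁻¹({i})`. -/
def Homogeneous {β : Ordinal.{u}} {n : ℕ} {ι : Type v}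
    (c : Set.powersetCard (Set.Iio β) n → ι) (i : ι) (X : Set (Set.Iio β)) : Prop :=
  ∀ s : Set.powersetCard (Set.Iio β) n, (∀ x ∈ (s : Finset (Set.Iio β)), x ∈ X) → c s = i

/-- The subspace `X` of `β` is homeomorphic to the ordinal `α`. -/
def IsTopCopy {β : Ordinal.{u}} (X : Set (Set.Iio β)) (α : Ordinal.{u}) : Prop :=
  Nonempty (X ≃ₜ Set.Iio α)

/-- The subspace `X` of `β` is order-homeomorphic to the ordinal `α`: some bijection `X → α` is
both an order-isomorphism and a homeomorphism. -/
def IsClosedCopy {β : Ordinal.{u}} (X : Set (Set.Iio β)) (α : Ordinal.{u}) : Prop :=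
  ∃ e : X ≃o Set.Iio α, Continuous e ∧ Continuous e.symm

/-- The topological partition relation `β →_top (α_i)^n_{i ∈ ι}`. -/
def TopArrow (β : Ordinal.{u}) {ι : Type v} (α : ι → Ordinal.{u}) (n : ℕ) : Prop :=
  ∀ c : Set.powersetCard (Set.Iio β) n → ι,
    ∃ (X : Set (Set.Iio β)) (i : ι), Homogeneous c i X ∧ IsTopCopy X (α i)

/-- The closed partition relation `β →_cl (α_i)^n_{i ∈ ι}`. -/
def ClosedArrow (β : Ordinal.{u}) {ι : Type v} (α : ι → Ordinal.{u}) (n : ℕ) : Prop :=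
  ∀ c : Set.powersetCard (Set.Iio β) n → ι,
    ∃ (X : Set (Set.Iio β)) (i : ι), Homogeneous c i X ∧ IsClosedCopy X (α i)

/-- The topological ordinal Ramsey number `R^top(α_i)_{i ∈ ι}` exists and equals `ρ`. -/
def IsTopRamseyNumber {ι : Type v} (α : ι → Ordinal.{u}) (ρ : Ordinal.{u}) : Prop :=
  IsLeast {β : Ordinal.{u} | TopArrow β α 2} ρ

/-- The closed ordinal Ramsey number `R^cl(α_i)_{i ∈ ι}` exists and equals `ρ`. -/
def IsClosedRamseyNumber {ι : Type v} (α : ι → Ordinal.{u}) (ρ : Ordinal.{u}) : Prop :=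
  IsLeast {β : Ordinal.{u} | ClosedArrow β α 2} ρ

end OrdinalRamsey

/-! ### Ramsey theorems for increasing lists and for triples. -/

namespace OrdinalRamsey

open Filter

/-! The ordinals up to `ω ^ n` contain a tree of finite sequences (`node`) in which the children of
each node increase to it. If there is no blue set of `k` points, then for some `n` depending only on
`k` this tree contains a red closed copy of `ω ^ 2 + 1`: a node `z`, extensions `z ++ x i`
increasing to `z`, and extensions `z ++ (x i ++ y i j)` increasing to `z ++ x i`. This yields (1)
and (3).

Ramsey's theorem thins the labels so that, for patterns with at most `5 * n` entries, blueness of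
two nodes depends only on the lengths and the interleaving of their parts
(`exists_patternInvariant`). Pairs at the same level of the array have patterns realized
simultaneously by all pairs of a `k`-element family, so they cannot be blue (`not_siblings`,
`not_siblings'`, `not_cousins`).

Pairs at different levels have patterns governed by the three lengths `a < b < c`: three chain types
and three branch types. If every triple of lengths up to `n` had a blue type, finite Ramsey for
triples would give many lengths sharing one blue type, and a nested chain or a comb of nodes with
those lengths would be a blue clique. So some triple has no blue type
(`exists_triple_forall_not_tripleType`), and an array with these lengths is red.

For (2), every topological copy of `ω ^ 2` contains a closed one, so the two arrows hold for the
same `β` and have the same least element. -/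

/-- The infinite Ramsey theorem for colorings of the increasing lists of length `m`. -/
theorem exists_strictMono_list_coloring {κ : Type*} [Finite κ] (m : ℕ) (f : List ℕ → κ) :
    ∃ g : ℕ → ℕ, StrictMono g ∧ ∃ c, ∀ l : List ℕ, l.Pairwise (· < ·) → l.length = m →
      f (l.map g) = c := by
  induction m generalizing f with
  | zero =>
    refine ⟨id, strictMono_id, f [], fun l _ hl => ?_⟩
    rw [List.length_eq_zero_iff.1 hl, List.map_nil]
  | succ m ih =>
    choose G hG C hC using fun h : ℕ → ℕ =>
      ih (fun l => f (h 0 :: l.map (fun i => h (i + 1))))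
    -- `H n` enumerates the set left after `n` thinnings. The `+ 1` drops its first element `H n 0`,
    -- so all later diagonal elements lie where the color of a list starting with `H n 0` is already
    -- fixed.
    let H : ℕ → ℕ → ℕ := fun n => Nat.rec id (fun _ h i => h (G h i + 1)) n
    have hmono : ∀ n, StrictMono (H n) := by
      intro n
      induction n with
      | zero => exact strictMono_id
      | succ n ihn => exact fun a b hab => ihn (Nat.succ_lt_succ (hG _ hab))
    have hrange : ∀ n d i, ∃ j, H (n + 1 + d) i = H (n + 1) j := by
      intro n d
      induction d with
      | zero => exact fun i => ⟨i, rfl⟩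
      | succ d ihd => exact fun i => ihd _
    have hrange' : ∀ n p, n < p → ∃ j, H p 0 = H n (G (H n) j + 1) := by
      intro n p hnp
      obtain ⟨d, rfl⟩ := Nat.exists_eq_add_of_le (Nat.succ_le_of_lt hnp)
      exact hrange n d 0
    have ha : StrictMono fun n => H n 0 := by
      intro n p hnp
      obtain ⟨j, hj⟩ := hrange' n p hnp
      change H n 0 < H p 0
      rw [hj]
      exact hmono n (Nat.succ_pos _)
    have key : ∀ n (l : List ℕ), l.Pairwise (· < ·) → l.length = m → (∀ x ∈ l, n < x) →
        f (H n 0 :: l.map fun i => H i 0) = C (H n) := by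
      intro n l hl hlen hn
      choose! J hJ using hrange' n
      rw [← hC (H n) (l.map J) ?_ (by simpa using hlen)]
      · congr 2
        simp only [List.map_map]
        exact List.map_congr_left fun x hx => hJ x (hn x hx)
      · rw [List.pairwise_map]
        refine hl.imp_of_mem fun {a b} hxa hxb hab => ?_
        have h1 := ha hab
        simp only [hJ a (hn a hxa), hJ b (hn b hxb)] at h1
        have h2 := (hmono n).lt_iff_lt.1 h1
        exact (hG (H n)).lt_iff_lt.1 (by omega)
    obtain ⟨c, hc⟩ := Finite.exists_infinite_fiber fun n => C (H n)
    have hinf : ((fun n => C (H n)) ⁻¹' {c}).Infinite := Set.infinite_coe_iff.1 hc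
    refine ⟨fun i => H (Nat.nth (· ∈ (fun n => C (H n)) ⁻¹' {c}) i) 0,
      ha.comp (Nat.nth_strictMono hinf), c, fun l hl hlen => ?_⟩
    cases l with
    | nil => simp at hlen
    | cons a l =>
      have hmem : C (H (Nat.nth (· ∈ (fun n => C (H n)) ⁻¹' {c}) a)) = c :=
        Nat.nth_mem_of_infinite hinf a
      rw [List.pairwise_cons] at hl
      have := key (Nat.nth (· ∈ (fun n => C (H n)) ⁻¹' {c}) a)
        (l.map (Nat.nth (· ∈ (fun n => C (H n)) ⁻¹' {c}))) ?_ (by simpa using hlen) ?_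
      · exact (congrArg f (by simp)).trans (this.trans hmem)
      · rw [List.pairwise_map]
        exact hl.2.imp fun h => Nat.nth_strictMono hinf h
      · simp only [List.mem_map, forall_exists_index, and_imp, forall_apply_eq_imp_iff₂]
        exact fun x hx => Nat.nth_strictMono hinf (hl.1 x hx)

/-- The finite Ramsey theorem for colorings of triples. -/
theorem exists_bound_triple_coloring (κ : Type*) [Finite κ] (N : ℕ) :
    ∃ n : ℕ, ∀ f : ℕ → ℕ → ℕ → κ, ∃ q : ℕ → ℕ, StrictMono q ∧ (∀ i < N, q i ≤ n) ∧
      ∃ c, ∀ i j l, i < j → j < l → l < N → f (q i) (q j) (q l) = c := by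
  by_contra! hcon
  choose f hf using hcon
  -- Compactness: the counterexamples `f n` have an ultrafilter limit `F`, and a homogeneous
  -- sequence for `F` serves some `f n` on its first `N` terms.
  have hlim : ∀ a b c, ∃ x, ∀ᶠ n in hyperfilter ℕ, f n a b c = x := by
    intro a b c
    exact Ultrafilter.eventually_exists_iff.1 (Eventually.of_forall fun n => ⟨f n a b c, rfl⟩)
  choose F hF using hlim
  obtain ⟨g, hg, c, hc⟩ := exists_strictMono_list_coloring 3
    fun l => F (l.getD 0 0) (l.getD 1 0) (l.getD 2 0)
  have hev : ∀ᶠ n in hyperfilter ℕ, ∀ i ∈ Set.Iio N, ∀ j ∈ Set.Iio N, ∀ l ∈ Set.Iio N,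
      f n (g i) (g j) (g l) = F (g i) (g j) (g l) := by
    simp only [Filter.eventually_all_finite (Set.finite_Iio N)]
    exact fun i _ j _ l _ => hF _ _ _
  have hev' : ∀ᶠ n in hyperfilter ℕ, g N ≤ n :=
    (Nat.hyperfilter_le_atTop) (eventually_ge_atTop _)
  obtain ⟨n, hn, hn'⟩ := (hev.and hev').exists
  obtain ⟨i, j, l, hij, hjl, hl, h⟩ := hf n g hg (fun i hi => (hg hi).le.trans hn') c
  refine h ?_
  rw [hn i (hij.trans (hjl.trans hl)) j (hjl.trans hl) l hl]
  simpa using hc [i, j, l] (by simp; omega) rfl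

end OrdinalRamsey

/-! ### Patterns of increasing lists, and cliques built from chains and combs. -/

namespace OrdinalRamsey

/-- The concatenation of the members of `parts` whose positions are listed in `I`. -/
def select (I : List ℕ) (parts : List (List ℕ)) : List ℕ :=
  (I.map fun i => parts.getD i []).flatten

theorem select_sublist {I : List ℕ} {parts : List (List ℕ)}
    (hI : I.Sublist (List.range parts.length)) : (select I parts).Sublist parts.flatten := by
  have h : (List.range parts.length).map (fun i => parts.getD i []) = parts := by
    apply List.ext_getElem
    · simp
    · intro i h1 h2
      simp [h2]
  conv_rhs => rw [← h]
  exact (hI.map _).flatten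

theorem select_map (I : List ℕ) (parts : List (List ℕ)) (e : ℕ → ℕ) :
    select I (parts.map (List.map e)) = (select I parts).map e := by
  simp only [select, List.map_flatten, List.map_map]
  congr 1
  refine List.map_congr_left fun i _ => ?_
  simp [List.getD_eq_getElem?_getD, List.getElem?_map]
  cases parts[i]? <;> simp

theorem exists_strictMono_eq_map_range {l : List ℕ} (hl : l.Pairwise (· < ·)) :
    ∃ e : ℕ → ℕ, StrictMono e ∧ l = (List.range l.length).map e := by
  induction l using List.reverseRecOn with
  | nil => exact ⟨id, strictMono_id, rfl⟩
  | append_singleton l a ih =>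
    rw [List.pairwise_append] at hl
    obtain ⟨e, he, hle⟩ := ih hl.1
    have ha : ∀ i < l.length, e i < a := by
      intro i hi
      refine hl.2.2 _ ?_ a (by simp)
      rw [hle]
      exact List.mem_map_of_mem (List.mem_range.2 (by simpa using hi))
    refine ⟨fun i => if i < l.length then e i else a + (i - l.length), ?_, ?_⟩
    · intro i j hij
      have := he hij
      have := ha i
      dsimp only
      split_ifs <;> omega
    · rw [List.length_append, List.length_singleton, List.range_succ, List.map_append]
      congr 1
      · conv_lhs => rw [hle]
        refine List.map_congr_left fun i hi => ?_
        rw [if_pos (List.mem_range.1 hi)]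
      · simp

/-- The consecutive intervals of the given lengths, from `s` on. -/
def intervals : List ℕ → ℕ → List (List ℕ)
  | [], _ => []
  | a :: L, s => List.range' s a :: intervals L (s + a)

theorem flatten_intervals (L : List ℕ) (s : ℕ) :
    (intervals L s).flatten = List.range' s L.sum := by
  induction L generalizing s with
  | nil => simp [intervals]
  | cons a L ih => simp [intervals, ih]

theorem length_intervals (L : List ℕ) (s : ℕ) : (intervals L s).length = L.length := by
  induction L generalizing s with
  | nil => simp [intervals]
  | cons a L ih => simp [intervals, ih]

theorem eq_map_intervals {e : ℕ → ℕ} (parts : List (List ℕ)) (s : ℕ)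
    (h : parts.flatten = (List.range' s (parts.map List.length).sum).map e) :
    parts = (intervals (parts.map List.length) s).map (List.map e) := by
  induction parts generalizing s with
  | nil => rfl
  | cons p parts ih =>
    simp only [List.flatten_cons, List.map_cons, List.sum_cons, ← List.range'_append_1,
      List.map_append] at h
    obtain ⟨h1, h2⟩ := List.append_inj h (by simp)
    simp only [intervals, List.map_cons]
    rw [← h1, ← ih _ h2]

/-- Whether `B` holds between two selections from an increasing concatenation of lists depends only
on the lengths of these lists. -/
def PatternInvariant (B : List ℕ → List ℕ → Prop) (M : ℕ) : Prop :=
  ∀ (I J : List ℕ) (parts parts' : List (List ℕ)), parts.map List.length = parts'.map List.length →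
    I.Sublist (List.range parts.length) → J.Sublist (List.range parts.length) →
    parts.flatten.length ≤ M →
    parts.flatten.Pairwise (· < ·) → parts'.flatten.Pairwise (· < ·) →
    B (select I parts) (select J parts) → B (select I parts') (select J parts')

/-- Color an increasing list of length `M` by the set of all pairs of position lists whose entries
satisfy `B`. On a homogeneous set, only positions matter, and these are determined by the part
lengths. -/
theorem exists_patternInvariant (B : List ℕ → List ℕ → Prop) (M : ℕ) :
    ∃ g : ℕ → ℕ, StrictMono g ∧ PatternInvariant (fun s t => B (s.map g) (t.map g)) M := by
  let Pos := {P : List ℕ | P.Sublist (List.range M)}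
  have hfin : Finite Pos := by
    refine Set.Finite.to_subtype ((List.finite_toSet (List.range M).sublists).subset ?_)
    intro P hP
    simpa [Pos] using hP
  obtain ⟨g, hg, c, hc⟩ := exists_strictMono_list_coloring M
    (fun l (p : Pos × Pos) => B (p.1.1.map fun i => l.getD i 0) (p.2.1.map fun i => l.getD i 0))
  refine ⟨g, hg, ?_⟩
  have key : ∀ (P Q : Pos) (e : ℕ → ℕ), StrictMono e →
      (B ((P.1.map e).map g) ((Q.1.map e).map g) ↔ c (P, Q)) := by
    intro P Q e he
    have h := congrFun (hc ((List.range M).map e)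
      (List.pairwise_map.2 (List.pairwise_lt_range.imp fun h => he h)) (by simp)) (P, Q)
    rw [← h]
    have aux : ∀ R : Pos, (R.1.map e).map g =
        R.1.map fun i => (((List.range M).map e).map g).getD i 0 := by
      intro R
      rw [List.map_map]
      refine List.map_congr_left fun i hi => ?_
      have hiM : i < M := List.mem_range.1 (R.2.subset hi)
      simp [List.getD_eq_getElem?_getD, hiM]
    rw [aux P, aux Q]
  intro I J parts parts' hlen hI hJ hM h h' hB
  have hs : ∀ {ps : List (List ℕ)}, ps.map List.length = parts.map List.length →
      ps.flatten.Pairwise (· < ·) → ∃ e : ℕ → ℕ, StrictMono e ∧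
        ps = (intervals (parts.map List.length) 0).map (List.map e) := by
    intro ps hps hsort
    obtain ⟨e, he, heq⟩ := exists_strictMono_eq_map_range hsort
    refine ⟨e, he, ?_⟩
    rw [← hps]
    refine eq_map_intervals ps 0 ?_
    rwa [List.length_flatten, List.range_eq_range'] at heq
  obtain ⟨e, he, heq⟩ := hs rfl h
  obtain ⟨e', he', heq'⟩ := hs hlen.symm h'
  have hpos : ∀ {K : List ℕ}, K.Sublist (List.range parts.length) →
      select K (intervals (parts.map List.length) 0) ∈ Pos := by
    intro K hK
    refine (select_sublist (by simpa [length_intervals] using hK)).trans ?_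
    rw [flatten_intervals, ← List.range_eq_range', ← List.length_flatten]
    exact List.range_sublist.2 hM
  have h1 := key ⟨_, hpos hI⟩ ⟨_, hpos hJ⟩
  have h2 := (h1 e he).1 (by
    simp only [← select_map _ _ e]
    rw [← heq]
    exact hB)
  have h3 := (h1 e' he').2 h2
  simp only [← select_map _ _ e'] at h3
  rw [← heq'] at h3
  exact h3

/-- The `t`-th block of length `r`, for blocks of length at most `D`. -/
def blk (D t r : ℕ) : List ℕ := List.range' (t * D) r

@[simp]
theorem length_blk (D t r : ℕ) : (blk D t r).length = r := by simp [blk]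

/-- The blocks at the given places and of the given lengths. -/
def blks (D : ℕ) (ts : List (ℕ × ℕ)) : List (List ℕ) := ts.map fun p => blk D p.1 p.2

theorem pairwise_lt_flatten_blks {D : ℕ} {ts : List (ℕ × ℕ)} (hD : ∀ p ∈ ts, p.2 ≤ D)
    (h : (ts.map Prod.fst).Pairwise (· < ·)) : (blks D ts).flatten.Pairwise (· < ·) := by
  rw [List.pairwise_flatten]
  refine ⟨?_, ?_⟩
  · simp only [blks, List.mem_map, forall_exists_index, and_imp, forall_apply_eq_imp_iff₂]
    exact fun p _ => List.pairwise_lt_range'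
  · rw [List.pairwise_map] at h
    rw [blks, List.pairwise_map]
    refine h.imp_of_mem fun {p p'} hp _ hlt x hx y hy => ?_
    simp only [blk, List.mem_range'_1] at hx hy
    have h1 := hD p hp
    have h2 : (p.1 + 1) * D ≤ p'.1 * D := Nat.mul_le_mul_right _ hlt
    rw [Nat.add_mul, Nat.one_mul] at h2
    omega

/-- `B` holds between all lists of length `a` and their end extensions of length `b`. -/
def ChainType (B : List ℕ → List ℕ → Prop) (a b : ℕ) : Prop :=
  ∀ z u : List ℕ, (z ++ u).Pairwise (· < ·) → z.length = a → u.length = b - a → B z (z ++ u)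

/-- The three patterns of `z ++ u'` and `z ++ (u ++ w)`, for `z ++ u` and `z ++ u'` of equal
length. -/
def BranchType (B : List ℕ → List ℕ → Prop) (a b c : ℕ) (τ : Fin 3) : Prop :=
  ∀ z u u' w : List ℕ,
    (z ++ ![u ++ (u' ++ w), u ++ (w ++ u'), u' ++ (u ++ w)] τ).Pairwise (· < ·) → z.length = a →
    u.length = b - a → u'.length = b - a → w.length = c - b → B (z ++ u') (z ++ (u ++ w))

variable {B : List ℕ → List ℕ → Prop} {k : ℕ}

theorem range_eq_append_range' {a b : ℕ} (h : a ≤ b) :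
    List.range b = List.range a ++ List.range' a (b - a) := by
  have := List.range'_append_1 (s := 0) (m := a) (n := b - a)
  rw [Nat.zero_add, Nat.add_sub_cancel' h] at this
  rw [List.range_eq_range', List.range_eq_range', this]

theorem not_forall_chainType (hB : ∀ f : ℕ → List ℕ, ¬ ∀ i j, i < j → j < k → B (f i) (f j))
    {q : ℕ → ℕ} (hq : StrictMono q) : ¬ ∀ i j, i < j → j < k → ChainType B (q i) (q j) := by
  intro h
  refine hB (fun i => List.range (q i)) fun i j hij hj => ?_
  have hle := hq hij
  have e : List.range (q j) = List.range (q i) ++ List.range' (q i) (q j - q i) :=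
    range_eq_append_range' hle.le
  simp only [e]
  refine h i j hij hj _ _ ?_ (by simp) (by simp)
  rw [← e]
  exact List.pairwise_lt_range

/-- The clique is a comb: a spine of blocks `m t` leading from length `q t` to `q (t + 1)`, with a
tooth `b i` as long as `m i` leaving the spine at length `q i`. Two tooth ends branch exactly as in
`BranchType`. -/
theorem not_forall_branchType (hB : ∀ f : ℕ → List ℕ, ¬ ∀ i j, i < j → j < k → B (f i) (f j))
    {q : ℕ → ℕ} (hq : StrictMono q) (τ : Fin 3) :
    ¬ ∀ i j l, i < j → j < l → l < k + 1 → BranchType B (q i) (q j) (q l) τ := by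
  intro h
  set D := q (k + 1)
  -- Places of spine blocks (`μ`) and teeth (`ν`): each tooth just after its spine block, all teeth
  -- after the spine in reverse order, or each tooth just before its spine block.
  let μ : ℕ → ℕ := fun t => ![2 * t + 1, t + 1, 2 * t + 2] τ
  let ν : ℕ → ℕ := fun t => ![2 * t + 2, 2 * k + 2 - t, 2 * t + 1] τ
  let m : ℕ → ℕ × ℕ := fun t => (μ t, q (t + 1) - q t)
  let b : ℕ → ℕ × ℕ := fun t => (ν t, q (t + 1) - q t)
  let path : ℕ → List (ℕ × ℕ) := fun i => (0, q 0) :: (List.range i).map m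
  have hpath : ∀ i, (blks D (path i)).flatten.length = q i := by
    intro i
    induction i with
    | zero => simp [path, blks]
    | succ i ih =>
      have e : path (i + 1) = path i ++ [m i] := by simp [path, List.range_succ]
      have := hq (Nat.lt_succ_self i)
      rw [e, blks, List.map_append, List.flatten_append, List.length_append]
      rw [blks] at ih
      rw [ih]
      simp [m]
      simp only [Nat.succ_eq_add_one] at this
      omega
  refine hB (fun i => (blks D (path i ++ [b i])).flatten) fun i j hij hj => ?_
  let mid : List (ℕ × ℕ) := (List.range' (i + 1) (j - (i + 1))).map m
  have hr : List.range j = List.range i ++ ([i] ++ List.range' (i + 1) (j - (i + 1))) := by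
    rw [← List.append_assoc, ← List.range_succ]
    exact range_eq_append_range' hij
  have hj' : path j = path i ++ ([m i] ++ mid) := by
    simp only [path, hr, mid, List.map_append, List.cons_append, List.map_cons, List.map_nil]
  have hmid : (blks D (mid ++ [b j])).flatten.length = q (j + 1) - q (i + 1) := by
    have h1 := hpath j
    rw [hj'] at h1
    have h2 := hpath i
    have h3 := hq (Nat.lt_succ_self i)
    have h4 := hq (Nat.lt_succ_self j)
    simp only [blks, List.map_append, List.flatten_append, List.length_append] at h1 h2 ⊢
    simp only [List.map_cons, List.map_nil, List.flatten_cons, List.flatten_nil, List.append_nil,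
      length_blk, m, b] at h1 h2 ⊢
    have h5 := hq.monotone (Nat.succ_le_of_lt hij)
    simp only [Nat.succ_eq_add_one] at *
    omega
  have hsort : ∀ ts : List (ℕ × ℕ), (∀ p ∈ ts, p ∈ path i ++ [m i] ++ [b i] ++ mid ++ [b j]) →
      (ts.map Prod.fst).Pairwise (· < ·) → (blks D ts).flatten.Pairwise (· < ·) := by
    intro ts hts hp
    refine pairwise_lt_flatten_blks (fun p hp => ?_) hp
    have hle : ∀ t, t ≤ k → q (t + 1) - q t ≤ D := fun t ht =>
      (Nat.sub_le _ _).trans (hq.monotone (by omega))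
    have := hts p hp
    simp only [path, mid, List.mem_append, List.mem_cons, List.mem_map, List.mem_range,
      List.mem_range'_1, List.not_mem_nil, or_false] at this
    rcases this with ((((rfl | ⟨t, ht, rfl⟩) | rfl) | rfl) | ⟨t, ht, rfl⟩) | rfl
    · exact hq.monotone (Nat.zero_le _)
    all_goals exact hle _ (by omega)
  -- The `i`-th tooth plays `u'`, the spine block beside it `u`, and the rest of the spine with the
  -- `j`-th tooth plays `w`; the last length is `q (j + 1)`, whence `k + 1` lengths.
  have := h i (i + 1) (j + 1) (by omega) (by omega) (by omega)
    (blks D (path i)).flatten (blks D [m i]).flatten (blks D [b i]).flatten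
    (blks D (mid ++ [b j])).flatten ?_ (hpath i) (by simp [blks, m]) (by simp [blks, b]) hmid
  · rw [hj']
    simpa [blks] using this
  · have hflat : ∀ l l' : List (ℕ × ℕ), (blks D l).flatten ++ (blks D l').flatten =
        (blks D (l ++ l')).flatten := by simp [blks]
    have h3 : (τ = 0 ∧ (∀ t, μ t = 2 * t + 1) ∧ ∀ t, ν t = 2 * t + 2) ∨
        (τ = 1 ∧ (∀ t, μ t = t + 1) ∧ ∀ t, ν t = 2 * k + 2 - t) ∨
        (τ = 2 ∧ (∀ t, μ t = 2 * t + 2) ∧ ∀ t, ν t = 2 * t + 1) := by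
      fin_cases τ <;> simp [μ, ν]
    clear_value μ ν
    have hP1 : ∀ a, (List.range a).Pairwise (· < ·) := fun a => List.pairwise_lt_range
    have hP2 : ∀ a c, (List.range' a c).Pairwise (· < ·) := fun a c => List.pairwise_lt_range'
    rcases h3 with ⟨rfl, e1, e2⟩ | ⟨rfl, e1, e2⟩ | ⟨rfl, e1, e2⟩ <;>
    · simp only [Matrix.cons_val_zero, Matrix.cons_val_one, Matrix.cons_val, hflat]
      refine hsort _ (fun p hp => ?_) ?_
      · simp only [List.mem_append] at hp ⊢
        tauto
      · simp only [path, mid, m, b, e1, e2, List.map_append, List.map_cons, List.map_map,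
          List.pairwise_append, List.pairwise_cons, List.pairwise_map, List.mem_append,
          List.mem_cons, List.mem_map, List.mem_range, List.mem_range'_1, List.not_mem_nil,
          Function.comp_apply, List.map_nil, or_false, false_imp_iff, implies_true,
          List.Pairwise.nil, true_and, and_true, forall_eq, or_imp, forall_and,
          forall_exists_index, and_imp, forall_apply_eq_imp_iff₂]
        and_intros
        all_goals first
          | exact (hP1 _).imp fun h => by omega
          | exact (hP2 _ _).imp fun h => by omega
          | (intros; omega)

end OrdinalRamsey

/-! ### Excluding blue patterns and building the red array. -/

namespace OrdinalRamsey

variable {B : List ℕ → List ℕ → Prop} {k M : ℕ}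

theorem PatternInvariant.chainType (hinv : PatternInvariant B M) {a b : ℕ} (hab : a ≤ b)
    (hb : b ≤ M) {z u : List ℕ} (hs : (z ++ u).Pairwise (· < ·)) (hz : z.length = a)
    (hu : u.length = b - a) (h : B z (z ++ u)) : ChainType B a b := by
  intro z' u' hs' hz' hu'
  have := hinv [0] [0, 1] [z, u] [z', u'] (by simp [hz, hu, hz', hu']) (by simp)
    (by simp; decide) (by simp [hz, hu]; omega) (by simpa using hs) (by simpa using hs')
    (by simpa [select] using h)
  simpa [select] using this

theorem PatternInvariant.branchType (hinv : PatternInvariant B M) {a b c : ℕ} (hab : a ≤ b)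
    (hbc : b ≤ c) (hc : 2 * c ≤ M) {τ : Fin 3} {z u u' w : List ℕ}
    (hs : (z ++ ![u ++ (u' ++ w), u ++ (w ++ u'), u' ++ (u ++ w)] τ).Pairwise (· < ·))
    (hz : z.length = a) (hu : u.length = b - a) (hu' : u'.length = b - a) (hw : w.length = c - b)
    (h : B (z ++ u') (z ++ (u ++ w))) : BranchType B a b c τ := by
  intro z₁ u₁ u₁' w₁ hs₁ hz₁ hu₁ hu₁' hw₁
  have hτ : τ = 0 ∨ τ = 1 ∨ τ = 2 := by fin_cases τ <;> simp
  rcases hτ with rfl | rfl | rfl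
  · have := hinv [0, 2] [0, 1, 3] [z, u, u', w] [z₁, u₁, u₁', w₁] (by simp [*])
      (by simp; decide) (by simp; decide) (by simp [*]; omega) (by simpa using hs)
      (by simpa using hs₁) (by simpa [select] using h)
    simpa [select] using this
  · have := hinv [0, 3] [0, 1, 2] [z, u, w, u'] [z₁, u₁, w₁, u₁'] (by simp [*])
      (by simp; decide) (by simp; decide) (by simp [*]; omega) (by simpa using hs)
      (by simpa using hs₁) (by simpa [select] using h)
    simpa [select] using this
  · have := hinv [0, 1] [0, 2, 3] [z, u', u, w] [z₁, u₁', u₁, w₁] (by simp [*])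
      (by simp; decide) (by simp; decide) (by simp [*]; omega) (by simpa using hs)
      (by simpa using hs₁) (by simpa [select] using h)
    simpa [select] using this

/-- The chain and branch types of a triple of lengths. -/
def TripleType (B : List ℕ → List ℕ → Prop) (a b c : ℕ) : Fin 3 ⊕ Fin 3 → Prop
  | .inl τ => ChainType B (![a, a, b] τ) (![b, c, c] τ)
  | .inr τ => BranchType B a b c τ

theorem exists_triple_forall_not_tripleType (k : ℕ) : ∃ n : ℕ, ∀ B : List ℕ → List ℕ → Prop,
    (∀ f : ℕ → List ℕ, ¬ ∀ i j, i < j → j < k → B (f i) (f j)) →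
    ∃ a b c, a < b ∧ b < c ∧ c ≤ n ∧ ∀ t, ¬ TripleType B a b c t := by
  classical
  obtain ⟨n, hn⟩ := exists_bound_triple_coloring (Fin 3 ⊕ Fin 3) (2 * k + 3)
  refine ⟨n, fun B hB => ?_⟩
  by_contra! hcon
  -- The `default` color is never used on the triples that matter, since `hcon` supplies a type for
  -- each.
  obtain ⟨q, hq, hqn, t, ht⟩ := hn fun a b c =>
    if h : ∃ t, TripleType B a b c t then h.choose else default
  have key : ∀ i j l, i < j → j < l → l < 2 * k + 3 → TripleType B (q i) (q j) (q l) t := by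
    intro i j l hij hjl hl
    have h := hcon _ _ _ (hq hij) (hq hjl) (hqn l hl)
    rw [← ht i j l hij hjl hl, dif_pos h]
    exact h.choose_spec
  rcases t with τ | τ
  · have hτ : τ = 0 ∨ τ = 1 ∨ τ = 2 := by fin_cases τ <;> simp
    rcases hτ with rfl | rfl | rfl
    · exact not_forall_chainType hB hq fun i j hij hj =>
        key i j (j + 1) hij (by omega) (by omega)
    -- Only even indices are kept, so that an odd one is available as the middle length.
    · exact not_forall_chainType hB (q := fun i => q (2 * i)) (fun i j h => hq (by omega))
        fun i j hij hj => key (2 * i) (2 * i + 1) (2 * j) (by omega) (by omega) (by omega)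
    · exact not_forall_chainType hB (q := fun i => q (i + 1)) (fun i j h => hq (by omega))
        fun i j hij hj => key 0 (i + 1) (j + 1) (by omega) (by omega) (by omega)
  · exact not_forall_branchType hB hq τ fun i j l hij hjl hl => key i j l hij hjl (by omega)

/-- If all pairs from `f` realize one pattern, a single blue instance of it makes the first `k`
values of `f` a clique. -/
theorem PatternInvariant.not_of_clique (hinv : PatternInvariant B M)
    (hB : ∀ f : ℕ → List ℕ, ¬ ∀ i j, i < j → j < k → B (f i) (f j)) {D : ℕ} (I J : List ℕ)
    (ts : List (ℕ × ℕ)) (ts' : ℕ → ℕ → List (ℕ × ℕ)) (f : ℕ → List ℕ)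
    (hts : (ts.map Prod.fst).Pairwise (· < ·)) (hD : ∀ p ∈ ts, p.2 ≤ D)
    (hM : ts.length * D ≤ M)
    (hI : I.Sublist (List.range ts.length)) (hJ : J.Sublist (List.range ts.length))
    (h : ∀ i j, i < j → j < k → ((ts' i j).map Prod.fst).Pairwise (· < ·) ∧
      (ts' i j).map Prod.snd = ts.map Prod.snd ∧ select I (blks D (ts' i j)) = f i ∧
      select J (blks D (ts' i j)) = f j) :
    ¬ B (select I (blks D ts)) (select J (blks D ts)) := by
  intro hb
  refine hB f fun i j hij hj => ?_
  obtain ⟨h1, h2, h3, h4⟩ := h i j hij hj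
  have hlen : ∀ l : List (ℕ × ℕ), (blks D l).map List.length = l.map Prod.snd := by
    intro l
    simp [blks, Function.comp_def]
  have hD' : ∀ x ∈ ts.map Prod.snd, x ≤ D := by simpa using fun a b hab => hD (b, a) hab
  rw [← h3, ← h4]
  refine hinv I J (blks D ts) _ (by rw [hlen, hlen, h2]) (by simpa [blks] using hI)
    (by simpa [blks] using hJ) ?_ (pairwise_lt_flatten_blks hD hts)
    (pairwise_lt_flatten_blks (fun p hp => ?_) h1) hb
  · rw [List.length_flatten, hlen]
    refine le_trans ?_ hM
    simpa using List.sum_le_card_nsmul _ D hD'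
  · exact hD' _ (h2 ▸ List.mem_map_of_mem hp)

theorem PatternInvariant.not_siblings (hinv : PatternInvariant B M)
    (hB : ∀ f : ℕ → List ℕ, ¬ ∀ i j, i < j → j < k → B (f i) (f j)) {n a r s t : ℕ}
    (hM : 5 * n ≤ M) (ha : a ≤ n) (hr : r ≤ n) (hs : 0 < s) (hst : s < t) :
    ¬ B (blk n 0 a ++ blk n s r) (blk n 0 a ++ blk n t r) := by
  have := hinv.not_of_clique hB (D := n) [0, 1] [0, 2] [(0, a), (s, r), (t, r)]
    (fun i j => [(0, a), (i + 1, r), (j + 1, r)]) (fun i => blk n 0 a ++ blk n (i + 1) r)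
    (by simp; omega) (by simp [*]) (by simp; omega) (by simp; decide) (by simp; decide)
    (fun i j hij hj => by simp [select, blks]; omega)
  simpa [select, blks] using this

theorem PatternInvariant.not_siblings' (hinv : PatternInvariant B M)
    (hB : ∀ f : ℕ → List ℕ, ¬ ∀ i j, i < j → j < k → B (f i) (f j)) {n a r p s t t' : ℕ}
    (hM : 5 * n ≤ M) (ha : a ≤ n) (hr : r ≤ n) (hp : p ≤ n) (hs : 0 < s) (hst : s < t)
    (ht : t < t') :
    ¬ B (blk n 0 a ++ (blk n s r ++ blk n t p)) (blk n 0 a ++ (blk n s r ++ blk n t' p)) := by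
  have := hinv.not_of_clique hB (D := n) [0, 1, 2] [0, 1, 3] [(0, a), (s, r), (t, p), (t', p)]
    (fun i j => [(0, a), (1, r), (i + 2, p), (j + 2, p)])
    (fun i => blk n 0 a ++ (blk n 1 r ++ blk n (i + 2) p))
    (by simp; omega) (by simp [*]) (by simp; omega) (by simp; decide) (by simp; decide)
    (fun i j hij hj => by simp [select, blks]; omega)
  simpa [select, blks] using this

theorem PatternInvariant.not_cousins (hinv : PatternInvariant B M)
    (hB : ∀ f : ℕ → List ℕ, ¬ ∀ i j, i < j → j < k → B (f i) (f j)) {n a r p s t s' t' : ℕ}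
    (hM : 5 * n ≤ M) (ha : a ≤ n) (hr : r ≤ n) (hp : p ≤ n) (hs : 0 < s) (hst : s < t)
    (hst' : s' < t') (hss : s < s') (htt : t ≠ t') (hts : t ≠ s') :
    ¬ B (blk n 0 a ++ (blk n s r ++ blk n t p)) (blk n 0 a ++ (blk n s' r ++ blk n t' p)) := by
  -- The three interleavings are `s t s' t'`, `s s' t t'` and `s s' t' t`; the last needs a family
  -- whose final blocks move left as the index grows.
  rcases lt_or_gt_of_ne hts with h1 | h1
  · have := hinv.not_of_clique hB (D := n) [0, 1, 2] [0, 3, 4]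
      [(0, a), (s, r), (t, p), (s', r), (t', p)]
      (fun i j => [(0, a), (2 * i + 1, r), (2 * i + 2, p), (2 * j + 1, r), (2 * j + 2, p)])
      (fun i => blk n 0 a ++ (blk n (2 * i + 1) r ++ blk n (2 * i + 2) p))
      (by simp; omega) (by simp [*]) (by simp; omega) (by simp; decide) (by simp; decide)
      (fun i j hij hj => by simp [select, blks]; omega)
    simpa [select, blks] using this
  rcases lt_or_gt_of_ne htt with h2 | h2
  · have := hinv.not_of_clique hB (D := n) [0, 1, 3] [0, 2, 4]
      [(0, a), (s, r), (s', r), (t, p), (t', p)]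
      (fun i j => [(0, a), (i + 1, r), (j + 1, r), (k + 1 + i, p), (k + 1 + j, p)])
      (fun i => blk n 0 a ++ (blk n (i + 1) r ++ blk n (k + 1 + i) p))
      (by simp; omega) (by simp [*]) (by simp; omega) (by simp; decide) (by simp; decide)
      (fun i j hij hj => by simp [select, blks]; omega)
    simpa [select, blks] using this
  · have := hinv.not_of_clique hB (D := n) [0, 1, 4] [0, 2, 3]
      [(0, a), (s, r), (s', r), (t', p), (t, p)]
      (fun i j => [(0, a), (i + 1, r), (j + 1, r), (2 * k + 1 - j, p), (2 * k + 1 - i, p)])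
      (fun i => blk n 0 a ++ (blk n (i + 1) r ++ blk n (2 * k + 1 - i) p))
      (by simp; omega) (by simp [*]) (by simp; omega) (by simp; decide) (by simp; decide)
      (fun i j hij hj => by simp [select, blks]; omega)
    simpa [select, blks] using this

theorem exists_independent_array (k : ℕ) : ∃ n : ℕ, ∀ B : List ℕ → List ℕ → Prop,
    (∀ s t, B s t → B t s) →
    (∀ f : ℕ → List ℕ, ¬ ∀ i j, i < j → j < k → B (f i) (f j)) → PatternInvariant B (5 * n) →
    ∃ (z : List ℕ) (x : ℕ → List ℕ) (y : ℕ → ℕ → List ℕ) (p : ℕ → ℕ) (q : ℕ → ℕ → ℕ),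
      (∀ i j, (z ++ (x i ++ y i j)).length ≤ n) ∧ (StrictMono p ∧ ∀ i, StrictMono (q i)) ∧
      (∀ i, ∃ s, x i = p i :: s) ∧ (∀ i, (x i).length = (x 0).length) ∧
      (∀ i j, ∃ s, y i j = q i j :: s) ∧
      (∀ i, ¬ B z (z ++ x i)) ∧ (∀ i j, ¬ B z (z ++ (x i ++ y i j))) ∧
      (∀ i i', i ≠ i' → ¬ B (z ++ x i) (z ++ x i')) ∧
      (∀ i i' j, ¬ B (z ++ x i') (z ++ (x i ++ y i j))) ∧
      (∀ i j i' j', i ≠ i' ∨ j ≠ j' → ¬ B (z ++ (x i ++ y i j)) (z ++ (x i' ++ y i' j'))) := by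
  obtain ⟨n, hn⟩ := exists_triple_forall_not_tripleType k
  refine ⟨n, fun B hsymm hB hinv => ?_⟩
  obtain ⟨a, b, c, hab, hbc, hcn, ht⟩ := hn B hB
  have hpair : ∀ i j, i ≤ Nat.pair i j := Nat.left_le_pair
  have hblk : ∀ t r, 0 < r → blk n t r = t * n :: List.range' (t * n + 1) (r - 1) := by
    intro t r hr
    obtain ⟨r, rfl⟩ := Nat.exists_eq_add_of_lt hr
    simp [blk, List.range'_succ]
  have hmono : ∀ f : ℕ → ℕ, StrictMono f → StrictMono fun i => f i * n :=
    fun f hf i j hij => Nat.mul_lt_mul_of_pos_right (hf hij) (by omega)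
  have hsort : ∀ ts : List (ℕ × ℕ), (∀ p ∈ ts, p.2 ≤ n) → (ts.map Prod.fst).Pairwise (· < ·) →
      (blks n ts).flatten.Pairwise (· < ·) := fun ts => pairwise_lt_flatten_blks
  -- Odd places for `x i` and even ones for `y i j` avoid collisions; `i ≤ Nat.pair i j` puts `y i
  -- j` after `x i`, and injectivity of `Nat.pair` separates the `y i j`.
  refine ⟨blk n 0 a, fun i => blk n (2 * i + 1) (b - a),
    fun i j => blk n (2 * Nat.pair i j + 2) (c - b), fun i => (2 * i + 1) * n,
    fun i j => (2 * Nat.pair i j + 2) * n, ?_, ⟨hmono _ fun i j h => by omega, fun i => hmono _ ?_⟩,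
    fun i => ⟨_, hblk _ _ (by omega)⟩, by simp, fun i j => ⟨_, hblk _ _ (by omega)⟩, ?_, ?_, ?_, ?_,
    ?_⟩
  · intro i j
    simp
    omega
  · intro j j' h
    have := Nat.pair_lt_pair_right i h
    dsimp only
    omega
  · intro i h
    have h1 := hsort [(0, a), (2 * i + 1, b - a)] (by simp; omega) (by simp)
    exact ht (.inl 0) (hinv.chainType (a := a) (b := b) hab.le (by omega)
      (by simpa [blks] using h1) (by simp) (by simp) h)
  · intro i j h
    have := hpair i j
    have h1 := hsort [(0, a), (2 * i + 1, b - a), (2 * Nat.pair i j + 2, c - b)]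
      (by simp; omega) (by simp; omega)
    exact ht (.inl 1) (hinv.chainType (a := a) (b := c) (by omega) (by omega)
      (by simpa [blks] using h1) (by simp) (by simp; omega) h)
  · intro i i' hne h
    rcases lt_or_gt_of_ne hne with h' | h'
    · exact hinv.not_siblings hB (k := k) le_rfl (by omega) (by omega) (by omega) (by omega) h
    · exact hinv.not_siblings hB (k := k) le_rfl (by omega) (by omega) (by omega) (by omega)
        (hsymm _ _ h)
  · intro i i' j h
    have hij := hpair i j
    rcases lt_trichotomy i i' with h' | rfl | h'
    · rcases lt_or_ge (Nat.pair i j) i' with h2 | h2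
      · have h1 := hsort [(0, a), (2 * i + 1, b - a), (2 * Nat.pair i j + 2, c - b),
          (2 * i' + 1, b - a)] (by simp; omega) (by simp; omega)
        exact ht (.inr 1) (hinv.branchType hab.le hbc.le (by omega) (by simpa [blks] using h1)
          (by simp) (by simp) (by simp) (by simp) h)
      · have h1 := hsort [(0, a), (2 * i + 1, b - a), (2 * i' + 1, b - a),
          (2 * Nat.pair i j + 2, c - b)] (by simp; omega) (by simp; omega)
        exact ht (.inr 0) (hinv.branchType hab.le hbc.le (by omega) (by simpa [blks] using h1)
          (by simp) (by simp) (by simp) (by simp) h)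
    · have h1 := hsort [(0, a), (2 * i + 1, b - a), (2 * Nat.pair i j + 2, c - b)]
        (by simp; omega) (by simp; omega)
      rw [← List.append_assoc] at h
      exact ht (.inl 2) (hinv.chainType (a := b) (b := c) (by omega) (by omega)
        (by simpa [blks] using h1) (by simp; omega) (by simp) h)
    · have h1 := hsort [(0, a), (2 * i' + 1, b - a), (2 * i + 1, b - a),
        (2 * Nat.pair i j + 2, c - b)] (by simp; omega) (by simp; omega)
      exact ht (.inr 2) (hinv.branchType hab.le hbc.le (by omega) (by simpa [blks] using h1)
        (by simp) (by simp) (by simp) (by simp) h)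
  · have key : ∀ i j i' j', i < i' ∨ i = i' ∧ j < j' →
        ¬ B (blk n 0 a ++ (blk n (2 * i + 1) (b - a) ++ blk n (2 * Nat.pair i j + 2) (c - b)))
          (blk n 0 a ++ (blk n (2 * i' + 1) (b - a) ++ blk n (2 * Nat.pair i' j' + 2) (c - b))) := by
      rintro i j i' j' (h' | ⟨rfl, h'⟩)
      · have h1 := hpair i j
        have h2 := hpair i' j'
        have h3 : Nat.pair i j ≠ Nat.pair i' j' := fun h => h'.ne (Nat.pair_eq_pair.1 h).1
        exact hinv.not_cousins hB (k := k) le_rfl (by omega) (by omega) (by omega) (by omega)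
          (by omega) (by omega) (by omega) (by omega) (by omega)
      · have h1 := hpair i j
        have h2 := Nat.pair_lt_pair_right i h'
        exact hinv.not_siblings' hB (k := k) le_rfl (by omega) (by omega) (by omega) (by omega)
          (by omega) (by omega)
    intro i j i' j' hne h
    rcases lt_trichotomy i i' with h' | h' | h'
    · exact key _ _ _ _ (.inl h') h
    · rcases lt_trichotomy j j' with h2 | h2 | h2
      · exact key _ _ _ _ (.inr ⟨h', h2⟩) h
      · omega
      · exact key _ _ _ _ (.inr ⟨h'.symm, h2⟩) (hsymm _ _ h)
    · exact key _ _ _ _ (.inl h') (hsymm _ _ h)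

end OrdinalRamsey

/-! ### The tree of ordinals up to `ω ^ n`. -/

namespace OrdinalRamsey

open Ordinal

/-- The ordinal of Cantor-Bendixson rank `n - s.length` at the position `s` in the tree of finite
sequences below `ω ^ n`. -/
noncomputable def node : ℕ → List ℕ → Ordinal.{u}
  | n, [] => ω ^ n
  | 0, _ :: _ => 1
  | n + 1, a :: s => ω ^ n * a + node n s

theorem node_nil (n : ℕ) : node n [] = ω ^ n := by
  cases n <;> rfl

theorem node_cons (n a : ℕ) (s : List ℕ) : node (n + 1) (a :: s) = ω ^ n * a + node n s := rfl

theorem node_pos (n : ℕ) (s : List ℕ) : 0 < node n s := by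
  induction n generalizing s with
  | zero => cases s <;> simp [node]
  | succ n ih =>
    cases s with
    | nil => rw [node_nil]; exact pow_pos omega0_pos _
    | cons a s => exact (ih s).trans_le le_add_self

theorem node_le (n : ℕ) (s : List ℕ) : node n s ≤ ω ^ n := by
  induction n generalizing s with
  | zero => cases s <;> simp [node]
  | succ n ih =>
    cases s with
    | nil => rw [node_nil]
    | cons a s =>
      rw [node_cons]
      calc _ ≤ ω ^ n * (a : Ordinal) + ω ^ n := by gcongr; exact ih s
        _ = ω ^ n * ((a + 1 : ℕ) : Ordinal) := by push_cast; rw [mul_add_one]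
        _ ≤ ω ^ n * ω := by gcongr; exact (natCast_lt_omega0 _).le
        _ = _ := (pow_succ _ _).symm

theorem node_cons_le (n a : ℕ) (s : List ℕ) : node (n + 1) (a :: s) ≤ ω ^ n * (a + 1 : ℕ) := by
  push_cast
  rw [node_cons, mul_add_one]
  gcongr
  exact node_le n s

theorem node_cons_lt_node_cons (n : ℕ) {a b : ℕ} (h : a < b) (s t : List ℕ) :
    node (n + 1) (a :: s) < node (n + 1) (b :: t) := by
  refine (node_cons_le n a s).trans_lt ?_
  rw [node_cons]
  refine lt_of_le_of_lt ?_ (lt_add_of_pos_right _ (node_pos n t))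
  gcongr
  exact h

theorem node_cons_lt (n a : ℕ) (s : List ℕ) : node (n + 1) (a :: s) < ω ^ (n + 1) := by
  refine (node_cons_le n a s).trans_lt ?_
  rw [pow_succ]
  exact mul_lt_mul_of_pos_left (natCast_lt_omega0 _) (pow_pos omega0_pos _)

/-- The subtree above `z` is a translate of a smaller full tree, which reduces order and limits
there to the root. -/
theorem exists_node_append (z : List ℕ) (m : ℕ) :
    ∃ o, ∀ s, node (z.length + m) (z ++ s) = o + node m s := by
  induction z with
  | nil => exact ⟨0, fun s => by simp⟩
  | cons a z ih =>
    obtain ⟨o, ho⟩ := ih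
    refine ⟨ω ^ (z.length + m) * a + o, fun s => ?_⟩
    rw [List.length_cons, Nat.add_right_comm, List.cons_append, node_cons, ho, add_assoc]

theorem node_append_lt {n : ℕ} {z : List ℕ} (hz : z.length < n) {a b : ℕ} (h : a < b)
    (s t : List ℕ) : node n (z ++ a :: s) < node n (z ++ b :: t) := by
  obtain ⟨m, rfl⟩ := Nat.exists_eq_add_of_lt hz
  obtain ⟨o, ho⟩ := exists_node_append z (m + 1)
  rw [add_assoc, ho, ho]
  gcongr
  exact node_cons_lt_node_cons m h s t

theorem isLUB_range_node {n : ℕ} {z : List ℕ} (hz : z.length < n) {p : ℕ → ℕ} (hp : StrictMono p)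
    (s : ℕ → List ℕ) : IsLUB (Set.range fun j => node.{u} n (z ++ p j :: s j)) (node n z) := by
  obtain ⟨m, rfl⟩ := Nat.exists_eq_add_of_lt hz
  obtain ⟨o, ho⟩ := exists_node_append.{u} z (m + 1)
  have ho' := ho []
  rw [List.append_nil, node_nil] at ho'
  simp only [add_assoc, ho, ho']
  refine ⟨?_, fun u hu => ?_⟩
  · rintro _ ⟨j, rfl⟩
    dsimp only
    gcongr
    exact (node_cons_lt m _ _).le
  · by_contra! hlt
    obtain ⟨d, hd, hud⟩ := (lt_add_iff (pow_pos omega0_pos _).ne').1 hlt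
    rw [pow_succ, lt_mul_iff_of_isSuccLimit isSuccLimit_omega0] at hd
    obtain ⟨c, hc, hdc⟩ := hd
    obtain ⟨a, rfl⟩ := lt_omega0.1 hc
    refine (hu ⟨a, rfl⟩).not_gt (hud.trans_lt ?_)
    dsimp only
    gcongr
    refine hdc.trans_le ?_
    rw [node_cons]
    refine le_trans ?_ le_self_add
    gcongr
    exact hp.id_le a

/-- A relation without cliques of size `k` on the ordinals up to `ω ^ n` vanishes on a closed copy
of `ω ^ 2 + 1`, given by its points `F a b` and its largest point. -/
theorem exists_independent_closed_array (k : ℕ) : ∃ n : ℕ, ∀ R : Ordinal.{u} → Ordinal.{u} → Prop,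
    (∀ x y, R x y → R y x) →
    (∀ f : ℕ → Ordinal, (∀ i, f i ≤ ω ^ n) → ¬ ∀ i j, i < j → j < k → R (f i) (f j)) →
    ∃ (F : ℕ → ℕ → Ordinal) (z : Ordinal), z ≤ ω ^ n ∧ (∀ a, StrictMono (F a)) ∧
      (∀ a, IsLUB (Set.range (F a)) (F (a + 1) 0)) ∧ IsLUB (Set.range fun a => F a 0) z ∧
      (∀ a b, ¬ R z (F a b)) ∧ ∀ a b a' b', a ≠ a' ∨ b ≠ b' → ¬ R (F a b) (F a' b') := by
  obtain ⟨n, hn⟩ := exists_independent_array k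
  refine ⟨n, fun R hsymm hR => ?_⟩
  obtain ⟨g, hg, hinv⟩ := exists_patternInvariant (fun s t => R (node n s) (node n t)) (5 * n)
  obtain ⟨z, x, y, p, q, hlen, ⟨hp, hq⟩, hx, hxl, hy, h1, h2, h3, h4, h5⟩ :=
    hn (fun s t => R (node n (s.map g)) (node n (t.map g))) (fun s t => hsymm _ _) (fun f => hR _ fun i => node_le n _) hinv
  choose s hs using hx
  choose t ht using hy
  have hxlen : ∀ i, 0 < (x i).length := fun i => by simp [hs]
  have hylen : ∀ i j, 0 < (y i j).length := fun i j => by simp [ht]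
  have hzn : (z.map g).length < n := by
    have := hlen 0 0
    have := hxlen 0
    simp only [List.length_append] at *
    simp
    omega
  have hxn : ∀ i, ((z ++ x i).map g).length < n := by
    intro i
    have := hlen i 0
    have := hylen i 0
    simp only [List.length_append, List.length_map] at *
    omega
  have ex : ∀ i, (z ++ x i).map g = z.map g ++ g (p i) :: (s i).map g := fun i => by simp [hs]
  have ey : ∀ i j, (z ++ (x i ++ y i j)).map g =
      (z ++ x i).map g ++ g (q i j) :: (t i j).map g := fun i j => by simp [ht]
  have ey' : ∀ i j, (z ++ (x i ++ y i j)).map g =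
      z.map g ++ g (p i) :: ((s i).map g ++ (y i j).map g) := fun i j => by simp [hs]
  -- Row `a` starts at the limit point of `x a` and continues through the points below that of `x (a
  -- + 1)`, so it converges to the start of the next row.
  let F : ℕ → ℕ → Ordinal := fun a b => Nat.casesOn b (node n ((z ++ x a).map g))
    fun b => node n ((z ++ (x (a + 1) ++ y (a + 1) b)).map g)
  have hF : ∀ a, StrictMono (F a) := by
    intro a
    refine strictMono_nat_of_lt_succ fun b => ?_
    cases b with
    | zero =>
      simp only [F, ex, ey']
      exact node_append_lt hzn (hg (hp (Nat.lt_succ_self a))) _ _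
    | succ b =>
      simp only [F, ey]
      exact node_append_lt (hxn _) (hg (hq _ (Nat.lt_succ_self b))) _ _
  refine ⟨F, node n (z.map g), node_le n _, hF, fun a => ?_, ?_, ?_, ?_⟩
  · have := isLUB_range_node (hxn (a + 1)) (hg.comp (hq (a + 1))) fun b => (t (a + 1) b).map g
    simp only [Function.comp_apply, ← ey] at this
    refine ⟨?_, fun u hu => this.2 ?_⟩
    · rintro _ ⟨b, rfl⟩
      exact ((hF a) (Nat.lt_succ_self b)).le.trans (this.1 ⟨b, rfl⟩)
    · rintro _ ⟨b, rfl⟩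
      exact hu ⟨b + 1, rfl⟩
  · have := isLUB_range_node hzn (hg.comp hp) fun a => (s a).map g
    simp only [Function.comp_apply, ← ex] at this
    exact this
  · rintro a (_ | b)
    · exact h1 a
    · exact h2 _ _
  · rintro a (_ | b) a' (_ | b') hne
    · exact h3 a a' (by simpa using hne)
    · exact h4 _ _ _
    · exact fun h => h4 _ _ _ (hsymm _ _ h)
    · exact h5 _ _ _ _ (by omega)

end OrdinalRamsey

/-! ### Closed and topological copies. -/

namespace OrdinalRamsey

open Ordinal Filter Topology

/-- A normal map is continuous, and its inverse is too because rays of `α` pull back to traces of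
rays of `β`. -/
theorem isClosedCopy_range {α β : Ordinal.{u}} {φ : Set.Iio α → Set.Iio β}
    (hφ : Order.IsNormal φ) : IsClosedCopy (Set.range φ) α := by
  refine ⟨(hφ.strictMono.orderIso φ).symm, ?_, hφ.continuous.subtype_mk _⟩
  have hsymm : ∀ x : Set.range φ, φ ((hφ.strictMono.orderIso φ).symm x) = x := fun x =>
    congrArg Subtype.val ((hφ.strictMono.orderIso φ).apply_symm_apply x)
  rw [OrderTopology.continuous_iff]
  refine fun a => ⟨?_, ?_⟩
  · convert (isOpen_Ioi (a := φ a)).preimage (continuous_subtype_val (p := (· ∈ Set.range φ)))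
      using 1
    ext x
    simp only [Set.mem_preimage, Set.mem_Ioi]
    rw [← hsymm x, hφ.strictMono.lt_iff_lt]
  · convert (isOpen_Iio (a := φ a)).preimage (continuous_subtype_val (p := (· ∈ Set.range φ)))
      using 1
    ext x
    simp only [Set.mem_preimage, Set.mem_Iio]
    rw [← hsymm x, hφ.strictMono.lt_iff_lt]

theorem omega0_opow_two : ω ^ (2 : Ordinal.{u}) = ω * ω := by
  rw [show (2 : Ordinal.{u}) = ((2 : ℕ) : Ordinal) from rfl, opow_natCast, pow_two]

theorem omega0_mul_add_lt_opow_two (a b : ℕ) : ω * (a : Ordinal.{u}) + b < ω ^ (2 : Ordinal) := by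
  rw [omega0_opow_two, lt_mul_iff]
  exact ⟨a, natCast_lt_omega0 a, b, natCast_lt_omega0 b, rfl⟩

theorem exists_eq_omega0_mul_add {ξ : Ordinal.{u}} (h : ξ < ω ^ (2 : Ordinal)) :
    ∃ a b : ℕ, ξ = ω * a + b := by
  rw [omega0_opow_two, lt_mul_iff] at h
  obtain ⟨q, hq, r, hr, rfl⟩ := h
  obtain ⟨a, rfl⟩ := lt_omega0.1 hq
  obtain ⟨b, rfl⟩ := lt_omega0.1 hr
  exact ⟨a, b, rfl⟩

theorem eq_of_omega0_mul_add_eq {a b a' b' : ℕ}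
    (h : ω * (a : Ordinal.{u}) + b = ω * (a' : Ordinal.{u}) + b') : a = a' ∧ b = b' := by
  have h1 := congrArg (· / ω) h
  have h2 := congrArg (· % ω) h
  simp only [mul_add_div _ omega0_ne_zero, div_eq_zero_of_lt (natCast_lt_omega0 _), add_zero,
    mul_add_mod_self, mod_eq_of_lt (natCast_lt_omega0 _), Nat.cast_inj] at h1 h2
  exact ⟨h1, h2⟩

theorem lt_or_of_omega0_mul_add_lt {a b a' b' : ℕ}
    (h : ω * (a : Ordinal.{u}) + b < ω * (a' : Ordinal.{u}) + b') : a < a' ∨ a = a' ∧ b < b' := by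
  by_contra! hcon
  refine h.not_ge ?_
  rcases hcon.1.lt_or_eq with h1 | rfl
  · calc ω * (a' : Ordinal.{u}) + b' ≤ ω * (a' : Ordinal.{u}) + ω := by
          gcongr; exact (natCast_lt_omega0 b').le
      _ = ω * ((a' + 1 : ℕ) : Ordinal) := by push_cast; rw [mul_add_one]
      _ ≤ ω * (a : Ordinal) := by gcongr; exact h1
      _ ≤ _ := le_self_add
  · gcongr
    exact hcon.2 rfl

/-- Doubly indexed points of order type `ω ^ 2` form a closed copy of `ω ^ 2` if each row converges
to the first point of the next row, and a closed copy of `ω ^ 2 + 1` together with their least upper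
bound. -/
theorem exists_isNormal_of_array {α β : Ordinal.{u}} {F : ℕ → ℕ → Set.Iio β} {z : Set.Iio β}
    (hF : ∀ a, StrictMono (F a)) (hlub : ∀ a, IsLUB (Set.range (F a)) (F (a + 1) 0))
    (hα : α ≤ ω ^ (2 : Ordinal) ∨
      α ≤ ω ^ (2 : Ordinal) + 1 ∧ IsLUB (Set.range fun a => F a 0) z) :
    ∃ φ : Set.Iio α → Set.Iio β, Order.IsNormal φ ∧
      ∀ ξ, (∃ a b, φ ξ = F a b) ∨ ω ^ (2 : Ordinal) < α ∧ φ ξ = z := by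
  classical
  choose! c d hcd using fun ξ : Ordinal.{u} => exists_eq_omega0_mul_add (ξ := ξ)
  let φ : Set.Iio α → Set.Iio β := fun ξ =>
    if ξ.1 < ω ^ (2 : Ordinal) then F (c ξ.1) (d ξ.1) else z
  have hstep : ∀ a b, F a b < F (a + 1) 0 := fun a b =>
    (hF a (Nat.lt_succ_self b)).trans_le ((hlub a).1 ⟨b + 1, rfl⟩)
  have hmono0 : StrictMono fun a => F a 0 := strictMono_nat_of_lt_succ fun a => hstep a 0
  have hlex : ∀ a b a' b', a < a' ∨ a = a' ∧ b < b' → F a b < F a' b' := by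
    rintro a b a' b' (h | ⟨rfl, h⟩)
    · exact (hstep a b).trans_le ((hmono0.monotone h).trans ((hF a').monotone (Nat.zero_le _)))
    · exact hF a h
  have hφ : ∀ (a b : ℕ) (h : ω * (a : Ordinal.{u}) + b < α), φ ⟨_, h⟩ = F a b := by
    intro a b h
    have h1 := omega0_mul_add_lt_opow_two.{u} a b
    have h2 := hcd _ h1
    simp only [φ, if_pos h1]
    obtain ⟨h3, h4⟩ := eq_of_omega0_mul_add_eq h2
    rw [← h3, ← h4]
  have hz : ∀ ξ : Set.Iio α, ¬ ξ.1 < ω ^ (2 : Ordinal) → ξ.1 = ω ^ (2 : Ordinal) ∧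
      ω ^ (2 : Ordinal) < α ∧ IsLUB (Set.range fun a => F a 0) z := by
    intro ξ hξ
    rw [not_lt] at hξ
    rcases hα with h | h
    · exact absurd (ξ.2.trans_le h) hξ.not_gt
    · exact ⟨le_antisymm (Order.lt_add_one_iff.1 (lt_of_lt_of_le ξ.2 h.1)) hξ, hξ.trans_lt ξ.2, h.2⟩
  refine ⟨φ, (Order.isNormal_iff).2 ⟨?_, ?_⟩, ?_⟩
  · intro ξ η h
    have h' : ξ.1 < η.1 := h
    by_cases h2 : η.1 < ω ^ (2 : Ordinal)
    · have h1 := h'.trans h2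
      simp only [φ, if_pos h1, if_pos h2]
      rw [hcd _ h1, hcd _ h2] at h'
      exact hlex _ _ _ _ (lt_or_of_omega0_mul_add_lt h')
    · have h1 : ξ.1 < ω ^ (2 : Ordinal) := h'.trans_eq (hz η h2).1
      simp only [φ, if_pos h1, if_neg h2]
      exact (hstep _ _).trans_le ((hz η h2).2.2.1 ⟨_, rfl⟩)
  · intro o ho u hu
    have ho' : Order.IsSuccLimit o.1 := ho.subtypeVal (isLowerSet_Iio α)
    have hFu : ∀ a b : ℕ, ω * (a : Ordinal.{u}) + b < o.1 → F a b ≤ u := fun a b h => by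
      rw [← hφ a b (h.trans o.2)]
      exact hu ⟨_, _⟩ h
    by_cases h2 : o.1 < ω ^ (2 : Ordinal)
    · obtain ⟨a, b, hab⟩ := exists_eq_omega0_mul_add h2
      have hoα : ω * (a : Ordinal.{u}) + b < α := hab ▸ o.2
      have e : o = ⟨ω * (a : Ordinal.{u}) + b, hoα⟩ := Subtype.ext hab
      rw [e, hφ a b hoα]
      rcases b with _ | b
      · rcases a with _ | a
        · simp [hab] at ho'
        · refine (hlub a).2 ?_
          rintro _ ⟨b, rfl⟩
          refine hFu a b (lt_of_lt_of_eq ?_ hab.symm)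
          push_cast
          rw [mul_add_one, add_zero]
          gcongr
          exact natCast_lt_omega0 b
      · refine absurd ho' ?_
        rw [hab, Nat.cast_add, Nat.cast_one, ← add_assoc, ← Order.succ_eq_add_one]
        exact Order.not_isSuccLimit_succ _
    · simp only [φ, if_neg h2]
      refine (hz o h2).2.2.2 ?_
      rintro _ ⟨a, rfl⟩
      refine hFu a 0 ?_
      rw [(hz o h2).1]
      exact omega0_mul_add_lt_opow_two a 0
  · intro ξ
    by_cases h : ξ.1 < ω ^ (2 : Ordinal)
    · exact .inl ⟨_, _, if_pos h⟩
    · exact .inr ⟨(hz ξ h).2.1, if_neg h⟩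

theorem isClosedCopy_natCast {β : Ordinal.{u}} {X : Set (Set.Iio β)} (hX : X.Finite) {k : ℕ}
    (hk : X.ncard = k) : IsClosedCopy X (k : Ordinal.{u}) := by
  have hcard : hX.toFinset.card = k := by rw [← hk, Set.ncard_eq_toFinset_card X hX]
  have hnat : ∀ ξ : Set.Iio (k : Ordinal.{u}), ∃ i : Fin k, ξ.1 = (i : ℕ) := by
    intro ξ
    obtain ⟨i, hi⟩ := lt_omega0.1 (lt_trans ξ.2 (natCast_lt_omega0 k))
    exact ⟨⟨i, Nat.cast_lt.1 (hi ▸ ξ.2 : (i : Ordinal.{u}) < k)⟩, hi⟩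
  choose t ht using hnat
  let f := hX.toFinset.orderEmbOfFin hcard
  have hφ : Order.IsNormal fun ξ => f (t ξ) := by
    refine Order.isNormal_iff.2 ⟨fun ξ η h => f.strictMono ?_, fun o ho => ?_⟩
    · have h' : ξ.1 < η.1 := h
      rw [ht, ht] at h'
      exact_mod_cast h'
    · have ho' : Order.IsSuccLimit o.1 := ho.subtypeVal (isLowerSet_Iio _)
      exact absurd (omega0_le_of_isSuccLimit ho') (not_le.2 (ht o ▸ natCast_lt_omega0 _))
  have := isClosedCopy_range hφ
  convert this
  have hsurj : Function.Surjective t := fun i =>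
    ⟨⟨(i : ℕ), Set.mem_Iio.2 (Nat.cast_lt.2 i.2)⟩, Fin.ext (Nat.cast_injective (R := Ordinal.{u}) (ht _).symm)⟩
  rw [show (fun ξ => f (t ξ)) = f ∘ t from rfl, hsurj.range_comp]
  simp [f]

theorem exists_strictMono_comp {W : Type*} [LinearOrder W] [WellFoundedLT W] {f : ℕ → W}
    (hf : Function.Injective f) : ∃ g : ℕ → ℕ, StrictMono g ∧ StrictMono (f ∘ g) := by
  obtain ⟨g, h | h⟩ := exists_increasing_or_nonincreasing_subseq (· < ·) f
  · exact ⟨g, g.strictMono, fun m n => h m n⟩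
  · have hanti : ∀ n, f (g (n + 1)) < f (g n) := fun n =>
      lt_of_le_of_ne (not_lt.1 (h n (n + 1) n.lt_succ_self))
        fun h => by simpa using g.injective (hf h)
    exact absurd (strictAnti_nat_of_succ_lt (f := fun n => f (g n)) hanti)
      (not_strictAnti_of_wellFoundedLT _)

/-- A topological copy of `ω ^ 2` contains a closed one. -/
theorem exists_array_of_isTopCopy {β : Ordinal.{u}} {X : Set (Set.Iio β)}
    (hX : IsTopCopy X (ω ^ (2 : Ordinal))) : ∃ F : ℕ → ℕ → Set.Iio β, (∀ a b, F a b ∈ X) ∧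
      (∀ a, StrictMono (F a)) ∧ ∀ a, IsLUB (Set.range (F a)) (F (a + 1) 0) := by
  obtain ⟨h⟩ := hX
  let pt : ℕ → ℕ → Set.Iio (ω ^ (2 : Ordinal.{u})) := fun a b =>
    ⟨ω * a + b, omega0_mul_add_lt_opow_two a b⟩
  have hpt : ∀ a b a' b', pt a b = pt a' b' → a = a' ∧ b = b' := fun a b a' b' e =>
    eq_of_omega0_mul_add_eq (congrArg Subtype.val e)
  have hlub : ∀ a, IsLUB (Set.range (pt a)) (pt (a + 1) 0) := by
    intro a
    refine ⟨?_, fun v hv => ?_⟩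
    · rintro _ ⟨b, rfl⟩
      rw [← Subtype.coe_le_coe]
      simp only [pt, Nat.cast_add, Nat.cast_one, mul_add_one, Nat.cast_zero, add_zero]
      gcongr
      exact (natCast_lt_omega0 b).le
    · rw [← Subtype.coe_le_coe]
      simp only [pt, Nat.cast_add, Nat.cast_one, mul_add_one, Nat.cast_zero, add_zero]
      by_contra! hlt
      obtain ⟨d, hd, hvd⟩ := (lt_add_iff omega0_ne_zero).1 hlt
      obtain ⟨b, rfl⟩ := lt_omega0.1 hd
      have h1 : ω * (a : Ordinal.{u}) + (b + 1 : ℕ) ≤ v.1 := hv ⟨b + 1, rfl⟩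
      refine (h1.trans hvd).not_gt ?_
      gcongr
      exact b.lt_succ_self
  have hmono : ∀ a, Monotone (pt a) := by
    intro a b b' hb
    rw [← Subtype.coe_le_coe]
    simp only [pt]
    gcongr
  let w : ℕ → ℕ → Set.Iio β := fun a b => (h.symm (pt a b)).1
  have hw : ∀ a b a' b', w a b = w a' b' → a = a' ∧ b = b' := fun a b a' b' e =>
    hpt _ _ _ _ (h.symm.injective (Subtype.ext e))
  have hlim : ∀ a, Tendsto (w a) atTop (𝓝 (w (a + 1) 0)) := fun a =>
    ((continuous_subtype_val.comp h.symm.continuous).tendsto _).comp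
      (tendsto_atTop_isLUB (hmono a) (hlub a))
  -- Well-foundedness makes the limit points increase along `g` and each row along `s`; dropping `N
  -- a` terms then puts each row above the preceding limit point.
  obtain ⟨g, -, hg⟩ := exists_strictMono_comp (f := fun a => w (a + 1) 0)
    fun a a' e => by simpa using (hw _ _ _ _ e).1
  choose s hs hs' using fun a => exists_strictMono_comp (f := w a) fun b b' e => (hw _ _ _ _ e).2
  have hev : ∀ a, ∃ N, ∀ b, N ≤ b → w (g a + 1) 0 < w (g (a + 1)) (s (g (a + 1)) b) := fun a =>
    eventually_atTop.1 (((hlim (g (a + 1))).comp (hs _).tendsto_atTop).eventually_const_lt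
      (hg a.lt_succ_self))
  choose N hN using hev
  let F : ℕ → ℕ → Set.Iio β := fun a b => Nat.casesOn b (w (g a + 1) 0)
    fun b => w (g (a + 1)) (s (g (a + 1)) (b + N a))
  have hF : ∀ a, StrictMono (F a) := by
    intro a
    refine strictMono_nat_of_lt_succ fun b => ?_
    cases b with
    | zero => exact hN a _ (Nat.le_add_left _ _)
    | succ b => exact hs' _ (by omega)
  refine ⟨F, ?_, hF, fun a => isLUB_of_tendsto_atTop (hF a).monotone ?_⟩
  · rintro a (_ | b) <;> exact Subtype.property _
  · rw [← tendsto_add_atTop_iff_nat 1]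
    exact ((hlim (g (a + 1))).comp (hs _).tendsto_atTop).comp (tendsto_add_atTop_nat (N a))

end OrdinalRamsey

/-! ### From colorings to the theorem. -/

namespace OrdinalRamsey

open Ordinal

/-- The pair of `x` and `y` has color `1`. -/
def Blue {β : Ordinal.{u}} (c : Set.powersetCard (Set.Iio β) 2 → Fin 2) (x y : Set.Iio β) : Prop :=
  ∃ s : Set.powersetCard (Set.Iio β) 2, (s : Finset (Set.Iio β)) = {x, y} ∧ c s = 1

variable {β : Ordinal.{u}} {c : Set.powersetCard (Set.Iio β) 2 → Fin 2}

theorem Blue.symm {x y : Set.Iio β} (h : Blue c x y) : Blue c y x := by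
  obtain ⟨s, hs, h⟩ := h
  exact ⟨s, hs.trans (Finset.pair_comm x y), h⟩

theorem Blue.ne {x y : Set.Iio β} (h : Blue c x y) : x ≠ y := by
  rintro rfl
  obtain ⟨s, hs, -⟩ := h
  have := Set.powersetCard.card_eq s
  simp [hs] at this

theorem homogeneous_zero {X : Set (Set.Iio β)}
    (h : ∀ x ∈ X, ∀ y ∈ X, x ≠ y → ¬ Blue c x y) : Homogeneous c 0 X := by
  intro s hs
  obtain ⟨x, y, hne, hxy⟩ := Finset.card_eq_two.1 (Set.powersetCard.card_eq s)
  have h1 : c s ≠ 1 := fun h1 => h x (hs x (by simp [hxy])) y (hs y (by simp [hxy])) hne ⟨s, hxy, h1⟩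
  omega

theorem homogeneous_one {X : Set (Set.Iio β)}
    (h : ∀ x ∈ X, ∀ y ∈ X, x ≠ y → Blue c x y) : Homogeneous c 1 X := by
  intro s hs
  obtain ⟨x, y, hne, hxy⟩ := Finset.card_eq_two.1 (Set.powersetCard.card_eq s)
  obtain ⟨s', hs', h1⟩ := h x (hs x (by simp [hxy])) y (hs y (by simp [hxy])) hne
  rwa [Subtype.ext (hxy.trans hs'.symm)]

theorem Homogeneous.mono {ι : Type*} {n : ℕ} {c : Set.powersetCard (Set.Iio β) n → ι} {i : ι}
    {X Y : Set (Set.Iio β)} (h : Homogeneous c i X) (hYX : Y ⊆ X) : Homogeneous c i Y :=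
  fun s hs => h s fun x hx => hYX (hs x hx)

theorem exists_homogeneous_one {f : ℕ → Set.Iio β} {k : ℕ}
    (hf : ∀ i j, i < j → j < k → Blue c (f i) (f j)) :
    ∃ X, Homogeneous c 1 X ∧ X.Finite ∧ X.ncard = k := by
  have hf' : ∀ i < k, ∀ j < k, i ≠ j → Blue c (f i) (f j) := by
    intro i hi j hj hne
    rcases lt_or_gt_of_ne hne with h | h
    · exact hf i j h hj
    · exact (hf j i h hi).symm
  refine ⟨f '' Set.Iio k, homogeneous_one ?_, (Set.finite_Iio k).image f, ?_⟩
  · rintro _ ⟨i, hi, rfl⟩ _ ⟨j, hj, rfl⟩ hne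
    exact hf' i hi j hj fun h => hne (congrArg f h)
  · rw [Set.InjOn.ncard_image]
    · simp
    · intro i hi j hj h
      by_contra hne
      exact (hf' i hi j hj hne).ne h

/-- A coloring of the pairs of `ω ^ ω` has a blue set of `k` points or a red closed copy of
`ω ^ 2 + 1`. -/
theorem exists_homogeneous (k : ℕ) (c : Set.powersetCard (Set.Iio (ω ^ ω : Ordinal.{u})) 2 → Fin 2) :
    (∃ X, Homogeneous c 1 X ∧ X.Finite ∧ X.ncard = k) ∨
    ∀ α ≤ ω ^ (2 : Ordinal) + 1, ∃ X, Homogeneous c 0 X ∧ IsClosedCopy X α := by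
  obtain ⟨n, hn⟩ := exists_independent_closed_array.{u} k
  refine or_iff_not_imp_left.2 fun hcon α hα => ?_
  have hlt : ∀ {x : Ordinal.{u}}, x ≤ ω ^ n → x < ω ^ ω := fun {x} hx => by
    refine hx.trans_lt ?_
    rw [← opow_natCast, opow_lt_opow_iff_right one_lt_omega0]
    exact natCast_lt_omega0 n
  obtain ⟨F, z, hz, hF, hlub, hlubz, hzF, hFF⟩ := hn
    (fun x y => ∃ hx hy, Blue c ⟨x, hx⟩ ⟨y, hy⟩) (fun x y ⟨hx, hy, h⟩ => ⟨hy, hx, h.symm⟩)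
    (fun f hf h => hcon (exists_homogeneous_one (f := fun i => ⟨f i, hlt (hf i)⟩)
      fun i j hij hj => (h i j hij hj).2.2))
  have hFz : ∀ a b, F a b ≤ z := fun a b =>
    ((hlub a).1 ⟨b, rfl⟩).trans (hlubz.1 ⟨a + 1, rfl⟩)
  let F' : ℕ → ℕ → Set.Iio (ω ^ ω : Ordinal.{u}) := fun a b => ⟨F a b, hlt ((hFz a b).trans hz)⟩
  let z' : Set.Iio (ω ^ ω : Ordinal.{u}) := ⟨z, hlt hz⟩
  have hsub : ∀ {f : ℕ → Set.Iio (ω ^ ω : Ordinal.{u})} {x : Set.Iio (ω ^ ω : Ordinal.{u})},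
      IsLUB (Set.range fun i => (f i).1) x.1 → IsLUB (Set.range f) x := by
    intro f x h
    refine ⟨?_, fun v hv => h.2 ?_⟩
    · rintro _ ⟨i, rfl⟩
      exact h.1 ⟨i, rfl⟩
    · rintro _ ⟨i, rfl⟩
      exact hv ⟨i, rfl⟩
  obtain ⟨φ, hφ, hr⟩ := exists_isNormal_of_array (α := α) (F := F') (z := z') (fun a b b' h => hF a h)
    (fun a => hsub (hlub a)) (.inr ⟨hα, hsub hlubz⟩)
  refine ⟨Set.range φ, homogeneous_zero ?_, isClosedCopy_range hφ⟩
  rintro _ ⟨ξ, rfl⟩ _ ⟨η, rfl⟩ hne hblue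
  rcases hr ξ with ⟨a, b, e⟩ | ⟨-, e⟩ <;> rcases hr η with ⟨a', b', e'⟩ | ⟨-, e'⟩ <;>
    rw [e, e'] at hne hblue
  · refine hFF a b a' b' ?_ ⟨_, _, hblue⟩
    by_contra! h
    exact hne (by rw [h.1, h.2])
  · exact hzF a b ⟨_, _, hblue.symm⟩
  · exact hzF a' b' ⟨_, _, hblue⟩
  · exact hne rfl

theorem ClosedArrow.topArrow {ι : Type*} {α : ι → Ordinal.{u}} {n : ℕ} (h : ClosedArrow β α n) :
    TopArrow β α n := by
  intro c
  obtain ⟨X, i, hX, e, he, he'⟩ := h c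
  exact ⟨X, i, hX, ⟨⟨e.toEquiv, he, he'⟩⟩⟩

theorem TopArrow.closedArrow {k : ℕ}
    (h : TopArrow β ![ω ^ (2 : Ordinal), (k : Ordinal.{u})] 2) :
    ClosedArrow β ![ω ^ (2 : Ordinal), (k : Ordinal.{u})] 2 := by
  intro c
  obtain ⟨X, i, hX, htop⟩ := h c
  have hi : i = 0 ∨ i = 1 := by fin_cases i <;> simp
  rcases hi with rfl | rfl
  · obtain ⟨F, hFX, hF, hlub⟩ := exists_array_of_isTopCopy htop
    -- `F 0 0` is a dummy top point: for `α = ω ^ 2` it is never a value required of `z`.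
    obtain ⟨φ, hφ, hr⟩ := exists_isNormal_of_array (α := ω ^ (2 : Ordinal)) (z := F 0 0) hF hlub
      (.inl le_rfl)
    refine ⟨Set.range φ, 0, hX.mono ?_, isClosedCopy_range hφ⟩
    rintro _ ⟨ξ, rfl⟩
    rcases hr ξ with ⟨a, b, e⟩ | ⟨-, e⟩ <;> exact e ▸ hFX _ _
  · obtain ⟨e⟩ := htop
    have hcard : Nat.card (Set.Iio (k : Ordinal.{u})) = k := by
      simp [Nat.card, Cardinal.mk_Iio_ordinal]
    have hfin : (Set.Iio (k : Ordinal.{u})).Finite := by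
      refine ((Set.finite_Iio k).image (fun i : ℕ => (i : Ordinal.{u}))).subset fun ξ hξ => ?_
      obtain ⟨i, rfl⟩ := lt_omega0.1 (lt_trans hξ (natCast_lt_omega0 k))
      exact ⟨i, Nat.cast_lt.1 (Set.mem_Iio.1 hξ), rfl⟩
    have e' : X ≃ Set.Iio (k : Ordinal.{u}) := e.toEquiv
    have := hfin.to_subtype
    have hX' : Finite X := Finite.of_equiv _ e'.symm
    refine ⟨X, 1, hX, isClosedCopy_natCast (Set.toFinite X) ?_⟩
    rw [← Nat.card_coe_set_eq, Nat.card_congr e', hcard]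

end OrdinalRamsey

theorem mainTheorem6 (k : ℕ) (hk : 0 < k) :
    -- the closed partition relation
    OrdinalRamsey.ClosedArrow (Ordinal.omega0.{u} ^ Ordinal.omega0.{u})
      ![Ordinal.omega0 ^ (2 : Ordinal), (k : Ordinal)] 2 ∧
    -- both Ramsey numbers exist, they are equal, and they are at most `ω ^ ω`
    (∃ ρ : Ordinal.{u}, ρ ≤ Ordinal.omega0 ^ Ordinal.omega0 ∧
      OrdinalRamsey.IsTopRamseyNumber ![Ordinal.omega0 ^ (2 : Ordinal), (k : Ordinal)] ρ ∧
      OrdinalRamsey.IsClosedRamseyNumber ![Ordinal.omega0 ^ (2 : Ordinal), (k : Ordinal)] ρ) ∧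
    -- the cofinal strengthening (color `0` is red, color `1` is blue)
    (∀ c : Set.powersetCard (Set.Iio (Ordinal.omega0 ^ Ordinal.omega0 : Ordinal.{u})) 2 → Fin 2,
      (∃ X, OrdinalRamsey.Homogeneous c 1 X ∧ X.ncard = k) ∨
      (∃ α : Ordinal, Ordinal.omega0 ^ (2 : Ordinal) < α ∧
        ∃ X, OrdinalRamsey.Homogeneous c 0 X ∧ OrdinalRamsey.IsClosedCopy X α) ∨
      (∃ X, OrdinalRamsey.Homogeneous c 0 X ∧
        OrdinalRamsey.IsClosedCopy X (Ordinal.omega0 ^ (2 : Ordinal)) ∧ IsCofinal X)) := by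
  have harrow : OrdinalRamsey.ClosedArrow (Ordinal.omega0.{u} ^ Ordinal.omega0.{u})
      ![Ordinal.omega0 ^ (2 : Ordinal), (k : Ordinal)] 2 := by
    intro c
    rcases OrdinalRamsey.exists_homogeneous k c with ⟨X, hX, hfin, hcard⟩ | h
    · exact ⟨X, 1, hX, OrdinalRamsey.isClosedCopy_natCast hfin hcard⟩
    · obtain ⟨X, hX, hcopy⟩ := h (Ordinal.omega0 ^ (2 : Ordinal)) le_self_add
      exact ⟨X, 0, hX, hcopy⟩
  refine ⟨harrow, ?_, fun c => ?_⟩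
  · let S := {β : Ordinal.{u} |
      OrdinalRamsey.ClosedArrow β ![Ordinal.omega0 ^ (2 : Ordinal), (k : Ordinal)] 2}
    have hmem : sInf S ∈ S := csInf_mem ⟨_, harrow⟩
    exact ⟨sInf S, csInf_le' harrow, ⟨hmem.topArrow, fun β hβ => csInf_le' hβ.closedArrow⟩,
      ⟨hmem, fun β hβ => csInf_le' hβ⟩⟩
  · rcases OrdinalRamsey.exists_homogeneous k c with ⟨X, hX, -, hcard⟩ | h
    · exact .inl ⟨X, hX, hcard⟩
    · obtain ⟨X, hX, hcopy⟩ := h (Ordinal.omega0 ^ (2 : Ordinal) + 1) le_rfl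
      -- The copy of `ω ^ 2 + 1` always settles the red case, so the cofinal alternative never
      -- arises.
      exact .inr (.inl ⟨_, Order.lt_add_one_iff.2 le_rfl, X, hX, hcopy⟩)
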